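/- Let $m,q,k\ge 1$ be integers and let $\Omega$ be an alphabet with $q$ letters. A cyclic sequence over $\Omega$ is a finite sequence $a_1a_2\ldots a_n$ of letters, considered up to rotation. A $k$-mer is an element of $\Omega^k$; a $k$-mer $y_1\ldots y_k$ occurs in the cyclic sequence $(a_1\ldots a_n)$ at position $i\in\{1,\ldots,n\}$ if $a_{i+j-1}=y_j$ for $j=1,\ldots,k$, with indices of $a$ read modulo $n$ (so occurrences may overlap, may wrap around the end, and may use a position more than once if $k>n$). Let $\mathcal{C}(m,q,k)$ be the set of cyclic sequences over $\Omega$ in which every $k$-mer occurs at exactly $m$ positions. Then $\mathcal{C}(m,q,k)$ is finite and $$|\mathcal{C}(m,q,k)| = \frac{1}{m\,q^k}\sum_{r\mid m}\phi(m/r)\,W(r,q,k),\qquad\text{where}\quad W(r,q,k)=\left(\frac{(rq)!}{r!^{\,q}}\right)^{q^{k-1}},$$ the sum is over the positive divisors $r$ of $m$, and $\phi$ is Euler's totient function. -/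

import Mathlib

namespace MultiDeBruijn

/-- The number of occurrences of the `k`-mer `y` in the linear sequence `s` read cyclically: the
number of starting positions `i < s.length` such that the letters at the positions
`i, i + 1, …, i + k - 1`, taken modulo the length of `s`, spell `y`. Occurrences may overlap, may
wrap around the end, and use positions repeatedly if `k` exceeds the length of `s`. -/
def listOccurrences {Ω : Type*} [DecidableEq Ω] {k : ℕ} (y : Fin k → Ω) (s : List Ω) : ℕ :=
  ((Finset.range s.length).filter
    (fun i => ∀ j : Fin k, s[(i + (j : ℕ)) % s.length]? = some (y j))).card

theorem listOccurrences_le_of_isRotated {Ω : Type*} [DecidableEq Ω] {k : ℕ} (y : Fin k → Ω)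
    {s t : List Ω} (h : s.IsRotated t) : listOccurrences y t ≤ listOccurrences y s := by
  obtain ⟨n, rfl⟩ := h
  unfold listOccurrences
  simp only [List.length_rotate]
  refine Finset.card_le_card_of_injOn (fun i => (i + n) % s.length) ?_ ?_
  · intro i hi
    simp only [Finset.coe_filter, Finset.mem_range, Set.mem_ofPred_eq] at hi ⊢
    obtain ⟨hi, hy⟩ := hi
    have hpos : 0 < s.length := by omega
    refine ⟨Nat.mod_lt _ hpos, fun j => ?_⟩
    have hj := hy j
    rw [List.getElem?_rotate (Nat.mod_lt _ hpos)] at hj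
    rw [← hj]
    congr 1
    rw [Nat.mod_add_mod, Nat.mod_add_mod]
    congr 1
    omega
  · intro a ha b hb hab
    simp only [Finset.coe_filter, Finset.mem_range, Set.mem_ofPred_eq] at ha hb hab
    have h1 : a ≡ b [MOD s.length] := Nat.ModEq.add_right_cancel' n hab
    exact Nat.ModEq.eq_of_lt_of_lt h1 ha.1 hb.1

theorem listOccurrences_eq_of_isRotated {Ω : Type*} [DecidableEq Ω] {k : ℕ} (y : Fin k → Ω)
    {s t : List Ω} (h : s.IsRotated t) : listOccurrences y s = listOccurrences y t :=
  le_antisymm (listOccurrences_le_of_isRotated y h.symm) (listOccurrences_le_of_isRotated y h)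

/-- The number of occurrences of the `k`-mer `y` in a cyclic sequence. A `Cycle Ω` is a linear
sequence up to rotation. -/
def occurrences {Ω : Type*} [DecidableEq Ω] {k : ℕ} (y : Fin k → Ω) (c : Cycle Ω) : ℕ :=
  Quotient.liftOn c (listOccurrences y) (fun _ _ h => listOccurrences_eq_of_isRotated y h)

/-- The set of cyclic multi de Bruijn sequences over the alphabet `Ω`: the cyclic sequences in
which every `k`-mer over `Ω` occurs exactly `m` times. -/
def cyclicMultiDeBruijn (Ω : Type*) [DecidableEq Ω] (m k : ℕ) : Set (Cycle Ω) :=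
  {c | ∀ y : Fin k → Ω, occurrences y c = m}

/-- `W(m, q, k) = ((mq)! / m! ^ q) ^ (q ^ (k - 1))`, used for `k ≥ 1` only. -/
def W (m q k : ℕ) : ℚ :=
  (((m * q).factorial : ℚ) / (m.factorial : ℚ) ^ q) ^ (q ^ (k - 1))

end MultiDeBruijn

/-!
Rotation makes the sequences of period `n = m * q ^ k` in which every `k`-mer occurs `m` times per
period into a `ZMod n`-set whose orbits are the cyclic sequences, so Burnside's lemma applies: a
rotation of order `e` fixes the sequences of period `n / e` in which every `k`-mer occurs `m / e`
times.

Such a sequence is a closed walk using every edge of the de Bruijn graph on the `(k - 1)`-mers `m`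
times. Listing at each vertex the letters of the successive exits turns the walk into its starting
vertex together with a word at each vertex containing every letter `m` times, and the tables
obtained in this way are those whose last exits form a tree directed towards the start (the BEST
theorem). By symmetry the last letter of such a word is equidistributed, so it remains to count the
pairs of a root and a tree. By the matrix-tree theorem this is, up to the choice of the exit from
the root, the derivative at `q` of the characteristic polynomial of the adjacency matrix `A`. All
rows of `A ^ (k - 1)` are equal, since a walk of `k - 1` steps forgets its start; hence this
polynomial is `X ^ (N - 1) * (X - q)`, where `N = q ^ (k - 1)`, and the number of pairs, with an
arbitrary exit from the root, is `q ^ N`.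
-/

namespace MultiDeBruijn

open Polynomial Matrix

section Determinants

variable {V R : Type*} [Fintype V] [DecidableEq V] [CommRing R]

theorem charmatrix_mul_charmatrix_of_mul_eq_zero {M N : Matrix V V R} (h : M * N = 0) :
    M.charmatrix * N.charmatrix = (X : R[X]) • (M + N).charmatrix := by
  have hMN : M.map C * N.map C = 0 := by
    rw [← Matrix.map_mul, h, Matrix.map_zero _ C.map_zero]
  simp only [charmatrix, RingHom.mapMatrix_apply, scalar_apply, ← smul_one_eq_diagonal,
    Matrix.map_add _ C.map_add]
  simp only [mul_sub, sub_mul, hMN, smul_mul_assoc, mul_smul_comm, one_mul, mul_one, smul_sub,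
    smul_add]
  abel

theorem X_pow_card_mul_charpoly_add {M N : Matrix V V R} (h : M * N = 0) :
    X ^ Fintype.card V * (M + N).charpoly = M.charpoly * N.charpoly := by
  simp only [charpoly, ← det_mul, charmatrix_mul_charmatrix_of_mul_eq_zero h, det_smul]

theorem charpoly_eq_X_pow_of_isNilpotent [IsDomain R] {M : Matrix V V R} (hM : IsNilpotent M) :
    M.charpoly = X ^ Fintype.card V :=
  sub_eq_zero.mp (isNilpotent_charpoly_sub_pow_of_isNilpotent hM).eq_zero

theorem charpoly_of_pow_eq_const [IsDomain R] [Nonempty V] {A : Matrix V V R} {q : R}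
    (hq : A *ᵥ 1 = q • 1) {K : ℕ} (hK : ∀ v w, (A ^ K) v = (A ^ K) w) :
    A.charpoly = X ^ (Fintype.card V - 1) * (X - C q) := by
  obtain ⟨w₀⟩ := ‹Nonempty V›
  set D := vecMulVec (1 : V → R) (Pi.single w₀ q) with hD
  have hker : (A - D) *ᵥ 1 = 0 := by
    rw [sub_mulVec, hq, hD, vecMulVec_mulVec, single_dotProduct]
    ext; simp
  have hmulD : (A - D) * D = 0 := by rw [hD, mul_vecMulVec, ← hD, hker, zero_vecMulVec]
  have hpow (i : ℕ) : (A - D) ^ (i + 1) = (A - D) * A ^ i := by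
    induction i with
    | zero => simp
    | succ i ih =>
      have : (A - D) * (A - D) = (A - D) * A := by rw [mul_sub, hmulD, sub_zero]
      rw [pow_succ', ih, ← mul_assoc, this, mul_assoc, ← pow_succ']
  have hnil : IsNilpotent (A - D) := by
    refine ⟨K + 1, ?_⟩
    have hAK : A ^ K = vecMulVec 1 ((A ^ K) w₀) := by
      ext v w
      simp [vecMulVec_apply, hK v w₀]
    rw [hpow, hAK, mul_vecMulVec, hker, zero_vecMulVec]
  have hprod := X_pow_card_mul_charpoly_add hmulD
  rw [sub_add_cancel, charpoly_eq_X_pow_of_isNilpotent hnil] at hprod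
  rw [mul_left_cancel₀ (pow_ne_zero _ X_ne_zero) hprod, hD, charpoly_vecMulVec, dotProduct_single,
    Pi.one_apply, one_mul, smul_eq_C_mul, mul_sub, ← pow_succ,
    Nat.sub_add_cancel (Fintype.card_pos_iff.mpr ⟨w₀⟩), mul_comm (C q)]

theorem derivative_det (M : Matrix V V R[X]) :
    derivative M.det = ∑ i, (M.updateRow i fun j => derivative (M i j)).det := by
  simp only [← det_transpose M, ← det_transpose (updateRow _ _ _), det_apply, derivative_sum,
    derivative_smul, derivative_prod_finset, Finset.smul_sum]
  rw [Finset.sum_comm]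
  refine Finset.sum_congr rfl fun i _ => Finset.sum_congr rfl fun σ _ => ?_
  rw [← Finset.prod_erase_mul _ _ (Finset.mem_univ i)]
  congr 2
  · refine Finset.prod_congr rfl fun j hj => ?_
    simp only [transpose_apply, updateRow_ne (Finset.ne_of_mem_erase hj)]
  · simp only [transpose_apply, updateRow_self]

theorem eval_derivative_charpoly (M : Matrix V V R) (t : R) :
    (derivative M.charpoly).eval t = (adjugate (scalar V t - M)).trace := by
  rw [charpoly, derivative_det, eval_finsetSum, trace]
  refine Finset.sum_congr rfl fun i _ => ?_
  rw [diag_apply, adjugate_apply, eval_det, matPolyEquiv_eval_eq_map]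
  congr 1
  ext j k
  rcases eq_or_ne j i with rfl | hj
  · rcases eq_or_ne k j with rfl | hk
    · simp
    · simp [hk, hk.symm]
  · simp [hj, charmatrix_apply, diagonal_apply, apply_ite]

end Determinants

/-- Every vertex is joined to `r` along `e`. If `e` is the graph of a partial function, its edges
at the vertices other than `r` then form a spanning tree directed towards the root `r`. -/
def IsRootedAt {V : Type*} (e : V → V → Prop) (r : V) : Prop :=
  ∀ v, Relation.ReflTransGen e v r

section MatrixTree

variable {V Ω R : Type*} [DecidableEq V] [Fintype Ω] [CommRing R]

/-- The adjacency matrix of the functional graph of `h` after deletion of the edge leaving `r`. -/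
def prunedMatrix (R : Type*) [CommRing R] (h : V → V) (r : V) : Matrix V V R :=
  Matrix.of fun v => if v = r then 0 else Pi.single (h v) 1

theorem prunedMatrix_apply (h : V → V) (r v : V) :
    prunedMatrix R h r v = if v = r then 0 else Pi.single (h v) 1 :=
  rfl

/-- The adjacency matrix of the digraph with an edge from `v` to `step v a` for each letter `a`. -/
def adjacency (R : Type*) [CommRing R] (step : V → Ω → V) : Matrix V V R :=
  Matrix.of fun v => ∑ a, Pi.single (step v a) 1

theorem adjacency_apply (step : V → Ω → V) (v : V) :
    adjacency R step v = ∑ a, Pi.single (step v a) 1 :=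
  rfl

variable [Fintype V]

theorem prunedMatrix_mulVec (h : V → V) (r : V) (x : V → R) (v : V) :
    (prunedMatrix R h r *ᵥ x) v = if v = r then 0 else x (h v) := by
  change prunedMatrix R h r v ⬝ᵥ x = _
  rw [prunedMatrix_apply]
  split_ifs <;> simp

theorem prunedMatrix_pow_succ_apply (h : V → V) (r : V) (n : ℕ) (v : V) :
    (prunedMatrix R h r ^ (n + 1)) v = if v = r then 0 else (prunedMatrix R h r ^ n) (h v) := by
  rw [pow_succ', mul_apply_eq_vecMul, prunedMatrix_apply]
  split_ifs <;> simp [row]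

theorem isNilpotent_prunedMatrix {h : V → V} {r : V} (hr : IsRootedAt (fun x y => h x = y) r) :
    IsNilpotent (prunedMatrix R h r) := by
  have hrow (v : V) : ∀ᶠ n in Filter.atTop, (prunedMatrix R h r ^ n) v = 0 := by
    induction hr v using Relation.ReflTransGen.head_induction_on with
    | refl =>
      filter_upwards [Filter.eventually_ge_atTop 1] with n hn
      obtain ⟨n, rfl⟩ := Nat.exists_eq_add_of_le' hn
      rw [prunedMatrix_pow_succ_apply, if_pos rfl]
    | head hvw _ ih =>
      rw [← Filter.map_add_atTop_eq_nat 1, Filter.eventually_map]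
      filter_upwards [ih] with n hn
      rw [prunedMatrix_pow_succ_apply, hvw, hn, ite_self]
  obtain ⟨n, hn⟩ := (Filter.eventually_all.mpr hrow).exists
  exact ⟨n, funext hn⟩

open Classical in
theorem det_one_sub_prunedMatrix [IsDomain R] (h : V → V) (r : V) :
    (1 - prunedMatrix R h r).det = if IsRootedAt (fun x y => h x = y) r then 1 else 0 := by
  split_ifs with hr
  · have := eval_charpoly (prunedMatrix R h r) 1
    rw [charpoly_eq_X_pow_of_isNilpotent (isNilpotent_prunedMatrix hr)] at this
    simpa using this.symm
  · obtain ⟨v₀, hv₀⟩ := not_forall.mp hr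
    refine exists_mulVec_eq_zero_iff.mp
      ⟨fun v => if Relation.ReflTransGen (fun x y => h x = y) v r then 0 else 1, fun h0 => ?_, ?_⟩
    · simpa [hv₀] using congrFun h0 v₀
    · ext v
      rw [sub_mulVec, one_mulVec, Pi.sub_apply, prunedMatrix_mulVec, Pi.zero_apply, sub_eq_zero]
      rcases eq_or_ne v r with rfl | hv
      · simp only [Relation.ReflTransGen.refl, if_true]
      · have : Relation.ReflTransGen (fun x y => h x = y) v r ↔
            Relation.ReflTransGen (fun x y => h x = y) (h v) r := by
          rw [Relation.ReflTransGen.cases_head_iff]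
          simp [hv]
        simp only [hv, this, if_false]

theorem adjacency_mulVec (step : V → Ω → V) (x : V → R) (v : V) :
    (adjacency R step *ᵥ x) v = ∑ a, x (step v a) := by
  change adjacency R step v ⬝ᵥ x = _
  simp [adjacency_apply, sum_dotProduct]

theorem adjacency_pow_succ_apply (step : V → Ω → V) (n : ℕ) (v : V) :
    (adjacency R step ^ (n + 1)) v = ∑ a, (adjacency R step ^ n) (step v a) := by
  rw [pow_succ', mul_apply_eq_vecMul, adjacency_apply]
  simp [row, sum_vecMul]

theorem card_mul_adjugate_laplacian [IsDomain R] (step : V → Ω → V) (r : V) :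
    (Fintype.card Ω : R) * adjugate (scalar V (Fintype.card Ω : R) - adjacency R step) r r =
      Nat.card {f : V → Ω // IsRootedAt (fun x y => step x (f x) = y) r} := by
  classical
  have hrows : (scalar V (Fintype.card Ω : R) - adjacency R step).updateRow r
      ((Fintype.card Ω : R) • Pi.single r 1) =
        of fun v => ∑ a, (1 - prunedMatrix R (fun x => step x a) r) v := by
    ext v w
    rcases eq_or_ne v r with rfl | hv
    · simp [prunedMatrix, one_apply, Pi.single_apply, eq_comm]
    · simp [prunedMatrix, adjacency, hv, one_apply, Matrix.natCast_apply]
  have hexpand := (detRowAlternating (n := V) (R := R)).toMultilinearMap.map_sum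
    fun v a => (1 - prunedMatrix R (fun x => step x a) r) v
  rw [adjugate_apply, ← det_updateRow_smul, hrows, Nat.card_eq_fintype_card, Fintype.card_subtype,
    Finset.natCast_card_filter]
  refine hexpand.trans (Finset.sum_congr rfl fun f _ => ?_)
  exact det_one_sub_prunedMatrix (fun x => step x (f x)) r

theorem card_mul_eval_derivative_charpoly_adjacency [IsDomain R] (step : V → Ω → V) :
    (Fintype.card Ω : R) * (derivative (adjacency R step).charpoly).eval (Fintype.card Ω : R) =
      Nat.card {p : V × (V → Ω) // IsRootedAt (fun x y => step x (p.2 x) = y) p.1} := by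
  rw [eval_derivative_charpoly, trace, Finset.mul_sum]
  simp only [diag_apply, card_mul_adjugate_laplacian]
  rw [← Nat.cast_sum, ← Nat.card_sigma]
  exact congrArg _ (Nat.card_congr (Equiv.subtypeProdEquivSigmaSubtype
    fun r (f : V → Ω) => IsRootedAt (fun x y => step x (f x) = y) r).symm)

end MatrixTree

section Shift

variable {Ω : Type*} {K : ℕ}

/-- The window obtained from `v` by dropping its first letter and appending `a`: these are the
edges of the de Bruijn graph on the `K`-mers. -/
def shift (v : Fin K → Ω) (a : Ω) : Fin K → Ω :=
  Fin.tail (Fin.snoc v a : Fin (K + 1) → Ω)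

theorem shift_congr {v w : Fin K → Ω} {i : ℕ} (h : ∀ j : Fin K, i + 1 ≤ j → v j = w j) (a : Ω)
    (j : Fin K) (hj : i ≤ j) : shift v a j = shift w a j := by
  simp only [shift, Fin.tail, Fin.snoc]
  split_ifs
  · exact h _ (by simpa using hj)
  · rfl

theorem foldl_shift_congr (s : List Ω) {v w : Fin K → Ω}
    (h : ∀ j : Fin K, s.length ≤ j → v j = w j) : s.foldl shift v = s.foldl shift w := by
  induction s generalizing v w with
  | nil => exact funext fun j => h j j.val.zero_le
  | cons a s ih => exact ih (shift_congr h a)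

variable [Fintype Ω]

theorem card_shift_fiber [DecidableEq Ω] (w : Fin K → Ω) :
    (Finset.univ.filter fun p : (Fin K → Ω) × Ω => shift p.1 p.2 = w).card = Fintype.card Ω := by
  refine Finset.card_bij' (t := Finset.univ)
    (fun p _ => (Fin.snoc p.1 p.2 : Fin (K + 1) → Ω) 0)
    (fun x _ => (Fin.init (Fin.cons x w : Fin (K + 1) → Ω),
      (Fin.cons x w : Fin (K + 1) → Ω) (Fin.last K)))
    (fun _ _ => Finset.mem_univ _) ?_ ?_ ?_
  · intro x _
    rw [Finset.mem_filter_univ, shift, Fin.snoc_init_self, Fin.tail_cons]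
  · rintro ⟨v, a⟩ hw
    obtain rfl := (Finset.mem_filter_univ _).mp hw
    simp only [shift, Fin.cons_self_tail, Fin.init_snoc, Fin.snoc_last]
  · intro x _
    rw [Fin.snoc_init_self, Fin.cons_zero]

theorem adjacency_shift_pow_congr [DecidableEq Ω] {R : Type*} [CommRing R] (i : ℕ) {v w : Fin K → Ω}
    (h : ∀ j : Fin K, i ≤ j → v j = w j) :
    (adjacency R (shift (Ω := Ω) (K := K)) ^ i) v = (adjacency R shift ^ i) w := by
  induction i generalizing v w with
  | zero => rw [funext fun j => h j j.val.zero_le]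
  | succ i ih =>
    rw [adjacency_pow_succ_apply, adjacency_pow_succ_apply]
    exact Finset.sum_congr rfl fun a _ => ih (shift_congr h a)

variable [Nonempty Ω]

theorem charpoly_adjacency_shift [DecidableEq Ω] {R : Type*} [CommRing R] [IsDomain R] :
    (adjacency R (shift (Ω := Ω) (K := K))).charpoly =
      X ^ (Fintype.card (Fin K → Ω) - 1) * (X - C (Fintype.card Ω : R)) := by
  refine charpoly_of_pow_eq_const (K := K) ?_ fun v w =>
    adjacency_shift_pow_congr K fun j hj => absurd j.isLt hj.not_gt
  ext v
  simp [adjacency_mulVec]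

theorem card_isRootedAt_shift :
    Nat.card {p : (Fin K → Ω) × ((Fin K → Ω) → Ω) //
        IsRootedAt (fun x y => shift x (p.2 x) = y) p.1} =
      Fintype.card Ω ^ Fintype.card (Fin K → Ω) := by
  classical
  have h := card_mul_eval_derivative_charpoly_adjacency (R := ℤ) (shift (Ω := Ω) (K := K))
  rw [charpoly_adjacency_shift] at h
  simp only [derivative_mul, derivative_sub, derivative_X, derivative_C, eval_add, eval_mul,
    eval_sub, eval_pow, eval_X, eval_C, sub_self, sub_zero, mul_zero, mul_one,
    zero_add, ← pow_succ', Nat.sub_add_cancel (Fintype.card_pos (α := Fin K → Ω))] at h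
  exact_mod_cast h.symm

end Shift

section ExitTables

variable {V Ω : Type*}

/-- A walk with exit table `T` leaves `v` for the last time by an edge to `w`. -/
def IsLastExit (step : V → Ω → V) (T : V → List Ω) (v w : V) : Prop :=
  ∃ a ∈ (T v).getLast?, step v a = w

theorem IsLastExit.of_append {step : V → Ω → V} {T R : V → List Ω} {v w : V}
    (h : IsLastExit step R v w) : IsLastExit step (fun x => T x ++ R x) v w := by
  obtain ⟨a, ha, hw⟩ := h
  exact ⟨a, List.mem_getLast?_append_of_mem_getLast? ha, hw⟩

variable [DecidableEq V]

/-- The exit table of the walk from `u` along the letters of `s`: it lists, for every vertex, the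
letters by which the walk leaves that vertex, in order. -/
def exitTable (step : V → Ω → V) : V → List Ω → V → List Ω
  | _, [] => fun _ => []
  | u, a :: s => fun v => (if v = u then [a] else []) ++ exitTable step (step u a) s v

theorem exitTable_injective (step : V → Ω → V) (u : V) :
    Function.Injective (exitTable step u) := by
  intro s t h
  induction s generalizing u t with
  | nil =>
    cases t with
    | nil => rfl
    | cons b t => simpa [exitTable] using congrFun h u
  | cons a s ih =>
    cases t with
    | nil => simpa [exitTable] using congrFun h u
    | cons b t =>
      obtain rfl : a = b := by
        have := congrFun h u
        simp only [exitTable, if_true, List.singleton_append, List.cons.injEq] at this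
        exact this.1
      rw [ih (step u a) (funext fun v => List.append_cancel_left (congrFun h v))]

theorem reflTransGen_isLastExit_exitTable (step : V → Ω → V) {u v : V} {s : List Ω}
    (hv : v = u ∨ exitTable step u s v ≠ []) :
    Relation.ReflTransGen (IsLastExit step (exitTable step u s)) v (s.foldl step u) := by
  induction s generalizing u v with
  | nil =>
    obtain rfl : v = u := by simpa [exitTable] using hv
    exact .refl
  | cons a s ih =>
    have hmono {x : V} (hx : x = step u a ∨ exitTable step (step u a) s x ≠ []) :
        Relation.ReflTransGen (IsLastExit step (exitTable step u (a :: s))) x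
          ((a :: s).foldl step u) :=
      Relation.ReflTransGen.mono (fun _ _ => IsLastExit.of_append) _ _ (ih hx)
    by_cases hx : exitTable step (step u a) s v = []
    · obtain rfl : v = u := by
        by_contra hvu
        simp [exitTable, hvu, hx] at hv
      exact .head ⟨a, by simp [exitTable, hx], rfl⟩ (hmono (.inl rfl))
    · exact hmono (.inr hx)

theorem exists_exitTable_append [Finite V] (step : V → Ω → V) (T : V → List Ω) (u : V) :
    ∃ (s : List Ω) (R : V → List Ω), T = (fun v => exitTable step u s v ++ R v) ∧
      R (s.foldl step u) = [] := by
  cases nonempty_fintype V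
  induction hn : ∑ v, (T v).length using Nat.strong_induction_on generalizing T u with
  | _ n ih
  rcases hu : T u with _ | ⟨a, l⟩
  · exact ⟨[], T, rfl, hu⟩
  · have hlt : ∑ v, (Function.update T u l v).length < n := by
      refine hn ▸ Finset.sum_lt_sum (fun v _ => ?_) ⟨u, Finset.mem_univ u, by simp [hu]⟩
      rcases eq_or_ne v u with rfl | hvu
      · simp [hu]
      · simp [hvu]
    obtain ⟨s, R, hT, hR⟩ := ih _ hlt (Function.update T u l) (step u a) rfl
    refine ⟨a :: s, R, funext fun v => ?_, hR⟩
    have hv := congrFun hT v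
    rcases eq_or_ne v u with rfl | hvu
    · rw [Function.update_self] at hv
      simp [exitTable, hu, hv]
    · rw [Function.update_of_ne hvu] at hv
      simp [exitTable, hvu, hv]

variable [Fintype V]

theorem sum_length_exitTable (step : V → Ω → V) (u : V) (s : List Ω) :
    ∑ v, (exitTable step u s v).length = s.length := by
  induction s generalizing u with
  | nil => simp [exitTable]
  | cons a s ih =>
    simp [exitTable, Finset.sum_add_distrib, ih, apply_ite List.length, Nat.add_comm]

/-- The number of entries of the table `T` that lead to `w`. -/
def inDegree (step : V → Ω → V) (T : V → List Ω) (w : V) : ℕ :=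
  ∑ v, (T v).countP fun a => step v a = w

theorem inDegree_append (step : V → Ω → V) (T R : V → List Ω) (w : V) :
    inDegree step (fun v => T v ++ R v) w = inDegree step T w + inDegree step R w := by
  simp only [inDegree, List.countP_append, Finset.sum_add_distrib]

theorem IsLastExit.inDegree_pos {step : V → Ω → V} {T : V → List Ω} {v w : V}
    (h : IsLastExit step T v w) : 0 < inDegree step T w := by
  obtain ⟨a, ha, rfl⟩ := h
  refine Finset.sum_pos' (fun _ _ => Nat.zero_le _) ⟨v, Finset.mem_univ v, ?_⟩
  exact List.countP_pos_iff.mpr ⟨a, List.mem_of_getLast? ha, by simp⟩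

/-- The degree condition satisfied by the exit table of a walk from `u` to `v`. -/
def IsBalanced (step : V → Ω → V) (T : V → List Ω) (u v : V) : Prop :=
  ∀ w, inDegree step T w + (if w = u then 1 else 0) = (T w).length + (if w = v then 1 else 0)

theorem isBalanced_exitTable (step : V → Ω → V) (u : V) (s : List Ω) :
    IsBalanced step (exitTable step u s) u (s.foldl step u) := by
  induction s generalizing u with
  | nil =>
    rw [List.foldl_nil]
    intro w
    simp [exitTable, inDegree]
  | cons a s ih =>
    intro w
    have hfirst : inDegree step (fun v => if v = u then [a] else []) w =
        if w = step u a then 1 else 0 := by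
      simp [inDegree, apply_ite (List.countP _), List.countP_singleton, eq_comm]
    have := ih (step u a) w
    rw [exitTable, inDegree_append, hfirst, List.length_append, List.foldl_cons,
      apply_ite List.length]
    simp only [List.length_singleton, List.length_nil]
    omega

theorem IsBalanced.of_append {step : V → Ω → V} {T R : V → List Ω} {u v w : V}
    (hTR : IsBalanced step (fun x => T x ++ R x) u w) (hT : IsBalanced step T u v) :
    IsBalanced step R v w := by
  intro x
  have := hTR x
  have := hT x
  simp only [inDegree_append, List.length_append] at *
  omega

theorem IsBalanced.eq_of_eq_nil {step : V → Ω → V} {R : V → List Ω} {x r : V}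
    (hR : IsBalanced step R x r) (hx : R x = []) : x = r := by
  by_contra hne
  simpa [hx, hne] using hR x

theorem IsBalanced.eq_nil_of_reflTransGen {step : V → Ω → V} {T R : V → List Ω} {v r : V}
    (hR : IsBalanced step R r r) (hr : R r = [])
    (hv : Relation.ReflTransGen (IsLastExit step fun x => T x ++ R x) v r) : R v = [] := by
  induction hv using Relation.ReflTransGen.head_induction_on with
  | refl => exact hr
  | @head v w hvw _ hw =>
    by_contra hne
    obtain ⟨a, ha, hstep⟩ := hvw
    have hlast : IsLastExit step R v w :=
      ⟨a, by rwa [List.getLast?_append_of_ne_nil _ hne] at ha, hstep⟩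
    have hpos := hlast.inDegree_pos
    have := hR w
    simp only [hw, List.length_nil] at this
    omega

theorem IsBalanced.end_unique {step : V → Ω → V} {T : V → List Ω} {u v w : V}
    (hv : IsBalanced step T u v) (hw : IsBalanced step T u w) : v = w := by
  by_contra hne
  have := hv v
  have := hw v
  simp only [if_true, if_neg hne] at *
  omega

theorem exists_exitTable_eq_iff {step : V → Ω → V} {T : V → List Ω} {u r : V}
    (hT : IsBalanced step T u r) :
    (∃ s, exitTable step u s = T) ↔
      ∀ v, T v ≠ [] → Relation.ReflTransGen (IsLastExit step T) v r := by
  constructor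
  · rintro ⟨s, rfl⟩ v hv
    rw [hT.end_unique (isBalanced_exitTable step u s)]
    exact reflTransGen_isLastExit_exitTable step (.inr hv)
  · intro h
    obtain ⟨s, R, rfl, hR⟩ := exists_exitTable_append step T u
    have hRbal := hT.of_append (isBalanced_exitTable step u s)
    obtain rfl := hRbal.eq_of_eq_nil hR
    refine ⟨s, funext fun v => ?_⟩
    by_cases hv : R v = []
    · rw [hv, List.append_nil]
    · exact absurd (hRbal.eq_nil_of_reflTransGen hR (h v (by simp [hv]))) hv

end ExitTables

section Words

variable {Ω : Type*} [DecidableEq Ω]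

/-- The words with `c a` occurrences of each letter `a`. -/
def wordsWithCounts (c : Ω → ℕ) : Set (List Ω) :=
  {l | ∀ a, l.count a = c a}

theorem map_mem_wordsWithCounts_const (σ : Equiv.Perm Ω) {m : ℕ} {l : List Ω}
    (hl : l ∈ wordsWithCounts fun _ => m) : l.map σ ∈ wordsWithCounts fun _ => m := by
  intro a
  rw [← σ.apply_symm_apply a, List.count_map_of_injective _ _ σ.injective]
  exact hl _

theorem prod_map_X_eq_monomial (l : List Ω) :
    (l.map MvPolynomial.X).prod =
      MvPolynomial.monomial (R := ℕ) (Multiset.toFinsupp (l : Multiset Ω)) 1 := by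
  induction l with
  | nil => simp
  | cons a l ih =>
    rw [List.map_cons, List.prod_cons, ih, MvPolynomial.X, MvPolynomial.monomial_mul,
      ← Multiset.cons_coe, ← Multiset.singleton_add, map_add, Multiset.toFinsupp_singleton, one_mul]

section LastLetter

variable [Nonempty Ω] {m : ℕ}

theorem ne_nil_of_mem_wordsWithCounts_const (hm : m ≠ 0) (l : wordsWithCounts fun _ : Ω => m) :
    l.1 ≠ [] := by
  intro hl
  obtain ⟨a⟩ := ‹Nonempty Ω›
  exact hm (by simpa [hl] using (l.2 a).symm)

variable (hm : m ≠ 0) (l : wordsWithCounts fun _ : Ω => m)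

/-- The last letter of a word in which every letter occurs `m ≠ 0` times. -/
def lastLetter : Ω :=
  l.1.getLast (ne_nil_of_mem_wordsWithCounts_const hm l)

theorem getLast?_eq_lastLetter : l.1.getLast? = some (lastLetter hm l) :=
  List.getLast?_eq_some_getLast _

end LastLetter

theorem sum_count_eq_length [Fintype Ω] (l : List Ω) : ∑ a, l.count a = l.length := by
  simpa using Multiset.sum_count_eq_card (s := Finset.univ) (m := (l : Multiset Ω))
    fun a _ => Finset.mem_univ a

theorem length_of_mem_wordsWithCounts [Fintype Ω] {c : Ω → ℕ} {l : List Ω}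
    (hl : l ∈ wordsWithCounts c) : l.length = ∑ a, c a := by
  rw [← sum_count_eq_length, Finset.sum_congr rfl fun a _ => hl a]

instance [Finite Ω] (c : Ω → ℕ) : Finite (wordsWithCounts c) := by
  cases nonempty_fintype Ω
  exact (List.finite_length_eq Ω (∑ a, c a)).subset fun _ => length_of_mem_wordsWithCounts

variable [Fintype Ω]

/-- Both sides are the coefficient of `∏ a, X a ^ c a` in `(∑ a, X a) ^ ∑ a, c a`. -/
theorem card_wordsWithCounts (c : Ω → ℕ) :
    Nat.card (wordsWithCounts c) = Nat.multinomial Finset.univ c := by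
  set d : Ω →₀ ℕ := Finsupp.equivFunOnFinite.symm c
  have hmem (l : List Ω) : l ∈ wordsWithCounts c ↔ Multiset.toFinsupp (l : Multiset Ω) = d := by
    simp [wordsWithCounts, Finsupp.ext_iff, d]
  have himage : wordsWithCounts c = List.ofFn ''
      {p : Fin (∑ a, c a) → Ω | Multiset.toFinsupp (List.ofFn p : Multiset Ω) = d} := by
    ext l
    refine ⟨fun hl => ?_, ?_⟩
    · obtain ⟨p, rfl⟩ : ∃ p : Fin (∑ a, c a) → Ω, List.ofFn p = l :=
        length_of_mem_wordsWithCounts hl ▸ ⟨l.get, List.ofFn_get l⟩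
      exact ⟨p, (hmem _).mp hl, rfl⟩
    · rintro ⟨p, hp, rfl⟩
      exact (hmem _).mpr hp
  have hcoeff := MvPolynomial.coeff_sum_X_pow_of_fintype (R := ℕ) d (∑ a, c a)
  have hd : (d.sum fun _ n => n) = ∑ a, c a := Finsupp.sum_fintype _ _ fun _ => rfl
  rw [if_pos hd, Fintype.sum_pow, MvPolynomial.coeff_sum, Nat.cast_id,
    ← Finsupp.multinomial_of_support_subset (Finset.subset_univ _)] at hcoeff
  have hprod {n : ℕ} (p : Fin n → Ω) : ∏ i, (MvPolynomial.X (p i) : MvPolynomial Ω ℕ) =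
      MvPolynomial.monomial (Multiset.toFinsupp (List.ofFn p : Multiset Ω)) 1 := by
    rw [← prod_map_X_eq_monomial, List.map_ofFn, List.prod_ofFn, Function.comp_def]
  simp only [hprod, MvPolynomial.coeff_monomial, Finset.sum_boole] at hcoeff
  rw [Nat.card_coe_set_eq, himage, Set.ncard_image_of_injective _ List.ofFn_injective,
    Set.ncard_eq_toFinset_card', Set.toFinset_ofPred]
  exact hcoeff

variable [Nonempty Ω] {m : ℕ}

theorem card_mul_card_lastLetter_fiber (hm : m ≠ 0) (a : Ω) :
    Fintype.card Ω * Nat.card {l : wordsWithCounts fun _ : Ω => m // lastLetter hm l = a} =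
      Nat.card (wordsWithCounts fun _ : Ω => m) := by
  have hle (a b : Ω) :
      Nat.card {l : wordsWithCounts fun _ : Ω => m // lastLetter hm l = a} ≤
        Nat.card {l : wordsWithCounts fun _ : Ω => m // lastLetter hm l = b} := by
    refine Nat.card_le_card_of_injective (fun l =>
      ⟨⟨l.1.1.map (Equiv.swap a b), map_mem_wordsWithCounts_const _ l.1.2⟩, ?_⟩) fun l l' h => ?_
    · exact (List.getLast_map _).trans ((congrArg _ l.2).trans (Equiv.swap_apply_left a b))
    · exact Subtype.ext (Subtype.ext (List.map_injective_iff.mpr (Equiv.injective _)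
        (congrArg (fun x => x.1.1) h)))
  rw [Nat.card_congr (Equiv.sigmaFiberEquiv (lastLetter hm)).symm, Nat.card_sigma,
    Finset.sum_congr rfl fun b _ => (hle b a).antisymm (hle a b), Finset.sum_const,
    Finset.card_univ, smul_eq_mul]

end Words

theorem card_comp_mem {ι P X Y : Type*} [Fintype ι] [Finite P] [Finite X] [Finite Y] {g : X → Y}
    {c : ℕ} (hg : ∀ y, Nat.card {x // g x = y} = c) (S : Set (P × (ι → Y))) :
    Nat.card {p : P × (ι → X) // (p.1, g ∘ p.2) ∈ S} = Nat.card S * c ^ Fintype.card ι := by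
  let e : {p : P × (ι → X) // (p.1, g ∘ p.2) ∈ S} ≃ Σ s : S, ∀ i, {x // g x = s.1.2 i} :=
    { toFun p := ⟨⟨(p.1.1, g ∘ p.1.2), p.2⟩, fun i => ⟨p.1.2 i, rfl⟩⟩
      invFun t := ⟨(t.1.1.1, fun i => (t.2 i).1), by
        rw [show g ∘ (fun i => (t.2 i).1) = t.1.1.2 from funext fun i => (t.2 i).2]
        exact t.1.2⟩
      left_inv _ := rfl
      right_inv := by
        rintro ⟨⟨⟨r, f⟩, hS⟩, t⟩
        obtain ⟨x, hx, rfl⟩ : ∃ (x : ι → X) (hx : ∀ i, g (x i) = f i), t = fun i => ⟨x i, hx i⟩ :=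
          ⟨_, fun i => (t i).2, rfl⟩
        obtain rfl : g ∘ x = f := funext hx
        rfl }
  have := Fintype.ofFinite S
  simp [Nat.card_congr e, Nat.card_sigma, Nat.card_pi, hg]

section RootedTables

variable {Ω : Type*} [DecidableEq Ω] {K m : ℕ}

/-- The pairs of a root and a table which is uniform, in the sense that every edge of the de Bruijn
graph on the `K`-mers is listed `m` times, and whose last exits form a tree directed towards the
root. These are the exit tables of the closed walks using every edge `m` times. -/
def rootedTables (Ω : Type*) [DecidableEq Ω] (K m : ℕ) :
    Set ((Fin K → Ω) × ((Fin K → Ω) → List Ω)) :=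
  {p | (∀ v, p.2 v ∈ wordsWithCounts fun _ => m) ∧ IsRootedAt (IsLastExit shift p.2) p.1}

variable [Fintype Ω]

theorem countP_eq_sum_count (p : Ω → Prop) [DecidablePred p] (l : List Ω) :
    l.countP (fun a => p a) = ∑ a with p a, l.count a := by
  rw [List.countP_eq_length_filter, ← sum_count_eq_length, Finset.sum_filter]
  refine Finset.sum_congr rfl fun a _ => ?_
  split_ifs with ha
  · rw [List.count_filter (by simpa using ha)]
  · simp [List.count_eq_zero, ha]

theorem isBalanced_shift_of_mem_wordsWithCounts {T : (Fin K → Ω) → List Ω}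
    (hT : ∀ v, T v ∈ wordsWithCounts fun _ => m) (r : Fin K → Ω) : IsBalanced shift T r r := by
  intro w
  have hin : inDegree shift T w = Fintype.card Ω * m := by
    simp only [inDegree, countP_eq_sum_count, Finset.sum_congr rfl fun a _ => hT _ a,
      Finset.sum_const, smul_eq_mul]
    rw [← Finset.sum_mul, ← card_shift_fiber w, Finset.card_filter, Fintype.sum_prod_type]
    simp only [Finset.card_filter]
  rw [hin, length_of_mem_wordsWithCounts (hT w), Finset.sum_const, Finset.card_univ, smul_eq_mul]

theorem card_rootedTables [Nonempty Ω] (hm : m ≠ 0) :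
    Nat.card (rootedTables Ω K m) =
      Nat.card (wordsWithCounts fun _ : Ω => m) ^ Fintype.card (Fin K → Ω) := by
  obtain ⟨a⟩ := ‹Nonempty Ω›
  have hfiber (b : Ω) := Nat.eq_of_mul_eq_mul_left (Fintype.card_pos_iff.mpr ⟨a⟩)
    ((card_mul_card_lastLetter_fiber hm b).trans (card_mul_card_lastLetter_fiber hm a).symm)
  have hrooted (T : (Fin K → Ω) → wordsWithCounts fun _ : Ω => m) (r : Fin K → Ω) :
      IsRootedAt (IsLastExit shift fun v => (T v).1) r ↔
        IsRootedAt (fun v w => shift v (lastLetter hm (T v)) = w) r := by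
    refine iff_of_eq (congrArg (IsRootedAt · r) ?_)
    ext v w
    simp only [IsLastExit, getLast?_eq_lastLetter hm, Option.mem_some_iff, exists_eq_left']
  let e : rootedTables Ω K m ≃ {p : (Fin K → Ω) × ((Fin K → Ω) → wordsWithCounts fun _ : Ω => m) //
      (p.1, lastLetter hm ∘ p.2) ∈
        {p | IsRootedAt (fun v w => shift v (p.2 v) = w) p.1}} :=
    { toFun p := ⟨(p.1.1, fun v => ⟨p.1.2 v, p.2.1 v⟩), (hrooted _ _).mp p.2.2⟩
      invFun p := ⟨(p.1.1, fun v => (p.1.2 v).1), fun v => (p.1.2 v).2, (hrooted _ _).mpr p.2⟩ }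
  rw [Nat.card_congr e, card_comp_mem hfiber, Set.coe_ofPred, card_isRootedAt_shift, ← mul_pow,
    card_mul_card_lastLetter_fiber]

end RootedTables

section Windows

variable {Ω : Type*} {k n : ℕ} {b : ℕ → Ω}

/-- The `k`-mer read in the sequence `b` from the position `i` on. -/
def window (k : ℕ) (b : ℕ → Ω) (i : ℕ) : Fin k → Ω :=
  fun j => b (i + j)

theorem window_comp_add (k : ℕ) (b : ℕ → Ω) (c i : ℕ) :
    window k (fun i => b (i + c)) i = window k b (i + c) :=
  funext fun j => congrArg b (Nat.add_right_comm i j c)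

theorem periodic_window (k : ℕ) (hb : Function.Periodic b n) : Function.Periodic (window k b) n :=
  fun i => funext fun j => (congrArg b (Nat.add_right_comm i n j)).trans (hb _)

theorem shift_window (b : ℕ → Ω) (i : ℕ) :
    shift (window k b i) (b (i + k)) = window k b (i + 1) := by
  ext j
  simp only [shift, Fin.tail, Fin.snoc, window, Fin.val_succ]
  split_ifs with hj
  · exact congrArg b (by simp; omega)
  · exact congrArg b (by omega)

theorem window_succ_eq_iff {i : ℕ} {y : Fin (k + 1) → Ω} :
    window (k + 1) b i = y ↔ window k b i = Fin.init y ∧ b (i + k) = y (Fin.last k) := by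
  simp only [funext_iff, Fin.forall_fin_succ', window, Fin.init, Fin.val_castSucc, Fin.val_last]

theorem eq_of_foldl_shift_eq_self {s : List Ω} (hs : s ≠ []) {v w : Fin k → Ω}
    (hv : s.foldl shift v = v) (hw : s.foldl shift w = w) : v = w := by
  have hfix {v : Fin k → Ω} (hv : s.foldl shift v = v) (i : ℕ) :
      (List.replicate i s).flatten.foldl shift v = v := by
    induction i with
    | zero => rfl
    | succ i ih => rw [List.replicate_succ, List.flatten_cons, List.foldl_append, hv, ih]
  have hlen : k ≤ (List.replicate k s).flatten.length := by
    simpa using Nat.le_mul_of_pos_right k (List.length_pos_of_ne_nil hs)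
  rw [← hfix hv k, ← hfix hw k]
  exact foldl_shift_congr _ fun j hj => absurd j.isLt (hlen.trans hj).not_gt

end Windows

section Walks

variable {V Ω : Type*} {step : V → Ω → V} {v : ℕ → V} {x : ℕ → Ω}

theorem foldl_map_range (h : ∀ i, step (v i) (x i) = v (i + 1)) (n : ℕ) :
    ((List.range n).map x).foldl step (v 0) = v n := by
  induction n with
  | zero => rfl
  | succ n ih => simp [List.range_succ, ih, h]

theorem count_exitTable_map_range [DecidableEq V] [DecidableEq Ω]
    (h : ∀ i, step (v i) (x i) = v (i + 1)) (n : ℕ) (w : V) (a : Ω) :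
    (exitTable step (v 0) ((List.range n).map x) w).count a =
      Nat.count (fun i => v i = w ∧ x i = a) n := by
  induction n generalizing v x with
  | zero => rfl
  | succ n ih =>
    have := ih (v := fun i => v (i + 1)) (x := fun i => x (i + 1)) fun i => h (i + 1)
    simp only [zero_add] at this
    simp only [List.range_succ_eq_map, List.map_cons, List.map_map, Function.comp_def,
      Nat.succ_eq_add_one, exitTable, h, zero_add, List.count_append, this, Nat.count_succ']
    rw [Nat.add_comm, apply_ite (List.count a), List.count_singleton, List.count_nil]
    simp only [beq_iff_eq, ← ite_and, eq_comm (a := v 0)]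

end Walks

theorem exists_periodic_map_range_eq {α : Type*} {s : List α} (hs : s ≠ []) :
    ∃ b : ℕ → α, Function.Periodic b s.length ∧ (List.range s.length).map b = s := by
  have hpos := List.length_pos_of_ne_nil hs
  refine ⟨fun i => s[i % s.length]'(Nat.mod_lt i hpos), fun i => by simp, ?_⟩
  refine List.ext_getElem (by simp) fun i _ hi => ?_
  simp [Nat.mod_eq_of_lt hi]

section PeriodicSequences

variable {Ω : Type*} [DecidableEq Ω] {n k K m : ℕ}

/-- The `n`-periodic sequences in which every `k`-mer occurs at `m` positions of a period. -/
def periodicSequences (Ω : Type*) [DecidableEq Ω] (n k m : ℕ) : Set (ℕ → Ω) :=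
  {b | Function.Periodic b n ∧ ∀ y : Fin k → Ω, Nat.count (fun i => window k b i = y) n = m}

/-- The first window of `b` and the exit table of the walk of length `n` that `b` describes in the
de Bruijn graph on the `K`-mers. -/
def windowExitTable (n K : ℕ) (b : ℕ → Ω) : (Fin K → Ω) × ((Fin K → Ω) → List Ω) :=
  (window K b 0, exitTable shift (window K b 0) ((List.range n).map fun i => b (i + K)))

theorem mem_periodicSequences_iff_windowExitTable {b : ℕ → Ω} :
    b ∈ periodicSequences Ω n (K + 1) m ↔ Function.Periodic b n ∧
      ∀ v, (windowExitTable n K b).2 v ∈ wordsWithCounts fun _ => m := by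
  refine and_congr_right fun _ => ?_
  have hcount (v : Fin K → Ω) (a : Ω) : ((windowExitTable n K b).2 v).count a =
      Nat.count (fun i => window K b i = v ∧ b (i + K) = a) n :=
    count_exitTable_map_range (shift_window b) n v a
  simp only [window_succ_eq_iff, wordsWithCounts, Set.mem_ofPred_eq, hcount]
  exact ⟨fun h v a => by simpa using h (Fin.snoc v a), fun h y => h _ _⟩

theorem injOn_windowExitTable (hn : n ≠ 0) :
    Set.InjOn (windowExitTable n K) {b : ℕ → Ω | Function.Periodic b n} := by
  intro b hb b' hb' h
  obtain ⟨hwindow, htable⟩ := Prod.ext_iff.mp h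
  simp only [windowExitTable] at hwindow htable
  rw [hwindow] at htable
  have hletters := List.map_inj_left.mp (exitTable_injective _ _ htable)
  ext i
  rw [← hb.map_mod_nat, ← hb'.map_mod_nat]
  have hi : i % n < n := Nat.mod_lt i (Nat.pos_of_ne_zero hn)
  rcases lt_or_ge (i % n) K with hK | hK
  · simpa [window] using congrFun hwindow ⟨i % n, hK⟩
  · simpa [hK] using hletters (i % n - K) (List.mem_range.mpr (by omega))

theorem mapsTo_windowExitTable [Finite Ω] [Nonempty Ω] (hm : m ≠ 0) :
    Set.MapsTo (windowExitTable n K) (periodicSequences Ω n (K + 1) m) (rootedTables Ω K m) := by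
  cases nonempty_fintype Ω
  intro b hb
  have huniform := (mem_periodicSequences_iff_windowExitTable.mp hb).2
  exact ⟨huniform, fun v =>
    (exists_exitTable_eq_iff (isBalanced_shift_of_mem_wordsWithCounts huniform _)).mp ⟨_, rfl⟩ v
      (ne_nil_of_mem_wordsWithCounts_const hm ⟨_, huniform v⟩)⟩

variable [Fintype Ω]

theorem surjOn_windowExitTable [Nonempty Ω] (hm : m ≠ 0)
    (hn : n = m * Fintype.card Ω ^ (K + 1)) :
    Set.SurjOn (windowExitTable n K) (periodicSequences Ω n (K + 1) m) (rootedTables Ω K m) := by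
  rintro ⟨u, T⟩ ⟨huniform, hroot⟩
  have hbal := isBalanced_shift_of_mem_wordsWithCounts huniform u
  obtain ⟨s, rfl⟩ := (exists_exitTable_eq_iff hbal).mpr fun v _ => hroot v
  have hlen : s.length = n := by
    rw [← sum_length_exitTable shift u s,
      Finset.sum_congr rfl fun v _ => length_of_mem_wordsWithCounts (huniform v), hn]
    simp only [Finset.sum_const, Finset.card_univ, Fintype.card_pi_const, smul_eq_mul]
    ring
  have hs : s ≠ [] := List.ne_nil_of_length_pos (by rw [hlen, hn]; positivity)
  obtain ⟨x, hx, hxs⟩ := exists_periodic_map_range_eq hs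
  rw [hlen] at hx hxs
  obtain ⟨c, hc⟩ : ∃ c, K * n = K + c :=
    Nat.exists_eq_add_of_le (Nat.le_mul_of_pos_right K (hlen ▸ List.length_pos_of_ne_nil hs))
  let b : ℕ → Ω := fun i => x (i + c)
  have hread : (fun i => b (i + K)) = x := funext fun i =>
    (congrArg x (by rw [Nat.cast_id, hc, Nat.add_assoc])).trans (hx.nat_mul K i)
  have hbper : Function.Periodic b n := fun i =>
    (congrArg x (Nat.add_right_comm i n c)).trans (hx _)
  have hstart : window K b 0 = u := by
    refine eq_of_foldl_shift_eq_self hs ?_ ?_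
    · rw [← hxs, ← hread, foldl_map_range (shift_window b), (periodic_window K hbper).eq]
    · exact (hbal.end_unique (isBalanced_exitTable shift u s)).symm
  have htable : windowExitTable n K b = (u, exitTable shift u s) := by
    rw [windowExitTable, hstart, hread, hxs]
  exact ⟨b, mem_periodicSequences_iff_windowExitTable.mpr ⟨hbper, by rwa [htable]⟩, htable⟩

theorem card_periodicSequences [Nonempty Ω] (hm : m ≠ 0) :
    Nat.card (periodicSequences Ω (m * Fintype.card Ω ^ (K + 1)) (K + 1) m) =
      Nat.card (wordsWithCounts fun _ : Ω => m) ^ Fintype.card Ω ^ K := by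
  have hn : m * Fintype.card Ω ^ (K + 1) ≠ 0 := by positivity
  have hbij := Set.BijOn.mk (mapsTo_windowExitTable hm)
    ((injOn_windowExitTable hn).mono fun _ hb => hb.1) (surjOn_windowExitTable (K := K) hm rfl)
  rw [Nat.card_congr (hbij.equiv _), card_rootedTables hm, Fintype.card_pi_const]

end PeriodicSequences

section Periods

variable {α : Type*} {b : ℕ → α} {n g : ℕ}

theorem iterate_comp_succ (b : ℕ → α) (n : ℕ) :
    (fun (b : ℕ → α) i => b (i + 1))^[n] b = fun i => b (i + n) := by
  induction n with
  | zero => rfl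
  | succ n ih =>
    rw [Function.iterate_succ_apply', ih]
    exact funext fun i => congrArg b (by omega)

theorem periodic_iff_isPeriodicPt :
    Function.Periodic b n ↔ Function.IsPeriodicPt (fun (b : ℕ → α) i => b (i + 1)) n b := by
  rw [Function.IsPeriodicPt, Function.IsFixedPt, iterate_comp_succ, funext_iff, Function.Periodic]

theorem periodic_gcd_iff (hn : Function.Periodic b n) :
    Function.Periodic b (n.gcd g) ↔ Function.Periodic b g := by
  rw [periodic_iff_isPeriodicPt] at hn
  simp only [periodic_iff_isPeriodicPt]
  exact ⟨fun h => h.trans_dvd (n.gcd_dvd_right g), hn.gcd⟩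

variable {p : ℕ → Prop} [DecidablePred p]

theorem count_comp_add_of_periodic (hp : Function.Periodic p n) (c : ℕ) :
    Nat.count (fun i => p (i + c)) n = Nat.count p n := by
  have h := Nat.count_add p n c
  rw [Nat.add_comm n c, Nat.count_add] at h
  simp only [Nat.add_comm n, Nat.add_comm c, hp _] at h
  exact Nat.add_left_cancel (h.trans (Nat.add_comm _ _))

theorem count_mul_of_periodic (hp : Function.Periodic p n) (e : ℕ) :
    Nat.count p (e * n) = e * Nat.count p n := by
  induction e with
  | zero => simp
  | succ e ih =>
    rw [Nat.succ_mul, Nat.count_add, ih, Nat.succ_mul]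
    simp only [Nat.add_comm (e * n)]
    rw [count_comp_add_of_periodic hp]

end Periods

section Rotations

variable {Ω : Type*} [DecidableEq Ω] {n k m d e : ℕ}

theorem comp_add_mem_periodicSequences {b : ℕ → Ω} (hb : b ∈ periodicSequences Ω n k m) (c : ℕ) :
    (fun i => b (i + c)) ∈ periodicSequences Ω n k m := by
  refine ⟨fun i => ?_, fun y => ?_⟩
  · exact (congrArg b (Nat.add_right_comm i n c)).trans (hb.1 _)
  · simp only [window_comp_add]
    rw [← hb.2 y]
    exact count_comp_add_of_periodic (p := fun i => window k b i = y)
      ((periodic_window k hb.1).comp (· = y)) c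

/-- The rotations of periodic sequences. -/
instance [NeZero n] : AddAction (ZMod n) (periodicSequences Ω n k m) where
  vadd g b := ⟨fun i => b.1 (i + g.val), comp_add_mem_periodicSequences b.2 _⟩
  zero_vadd b := Subtype.ext (funext fun i => congrArg (fun j => b.1 (i + j)) ZMod.val_zero)
  add_vadd g h b := Subtype.ext (funext fun i => by
    change b.1 (i + (g + h).val) = b.1 (i + g.val + h.val)
    rw [← b.2.1.map_mod_nat, ← b.2.1.map_mod_nat (i + g.val + h.val), ZMod.val_add,
      Nat.add_mod_mod, add_assoc])

theorem vadd_apply [NeZero n] (g : ZMod n) (b : periodicSequences Ω n k m) (i : ℕ) :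
    (g +ᵥ b).1 i = b.1 (i + g.val) :=
  rfl

theorem vadd_eq_self_iff [NeZero n] (g : ZMod n) (b : periodicSequences Ω n k m) :
    g +ᵥ b = b ↔ Function.Periodic b.1 (n / addOrderOf g) := by
  have hgcd : n / addOrderOf g = n.gcd g.val := by
    rw [← ZMod.natCast_zmod_val g, ZMod.addOrderOf_coe _ (NeZero.ne n), ZMod.natCast_zmod_val,
      Nat.div_div_self (n.gcd_dvd_left _) (NeZero.ne n)]
  rw [hgcd, periodic_gcd_iff b.2.1, Subtype.ext_iff, funext_iff]
  rfl

theorem count_window_mul {b : ℕ → Ω} (hb : Function.Periodic b d) (e : ℕ) (y : Fin k → Ω) :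
    Nat.count (fun i => window k b i = y) (e * d) = e * Nat.count (fun i => window k b i = y) d :=
  count_mul_of_periodic (p := fun i => window k b i = y) ((periodic_window k hb).comp (· = y)) e

theorem mem_periodicSequences_mul_iff (he : e ≠ 0) {b : ℕ → Ω} :
    b ∈ periodicSequences Ω (e * d) k (e * m) ∧ Function.Periodic b d ↔
      b ∈ periodicSequences Ω d k m := by
  constructor
  · rintro ⟨hb, hd⟩
    exact ⟨hd, fun y => Nat.eq_of_mul_eq_mul_left (Nat.pos_of_ne_zero he)
      ((count_window_mul hd e y).symm.trans (hb.2 y))⟩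
  · intro hb
    exact ⟨⟨hb.1.nat_mul e, fun y => by rw [count_window_mul hb.1, hb.2 y]⟩, hb.1⟩

theorem dvd_of_mem_periodicSequences_mul [Nonempty Ω] {b : ℕ → Ω}
    (hb : b ∈ periodicSequences Ω (e * d) k m) (hd : Function.Periodic b d) : e ∣ m := by
  obtain ⟨a⟩ := ‹Nonempty Ω›
  exact ⟨_, ((hb.2 fun _ => a).symm.trans (count_window_mul hd e _))⟩

theorem card_periodic_mem_periodicSequences_mul [Nonempty Ω] (he : e ≠ 0) :
    Nat.card {b : ℕ → Ω // b ∈ periodicSequences Ω (e * d) k m ∧ Function.Periodic b d} =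
      if e ∣ m then Nat.card (periodicSequences Ω d k (m / e)) else 0 := by
  split_ifs with h
  · obtain ⟨r, rfl⟩ := h
    rw [Nat.mul_div_cancel_left r (Nat.pos_of_ne_zero he)]
    exact Nat.card_congr (Equiv.subtypeEquivRight fun b => mem_periodicSequences_mul_iff he)
  · exact Nat.card_eq_zero.mpr
      (.inl ⟨fun b => h (dvd_of_mem_periodicSequences_mul b.2.1 b.2.2)⟩)

theorem card_fixedBy_periodicSequences [Nonempty Ω] [NeZero n] (g : ZMod n) :
    Nat.card (AddAction.fixedBy (periodicSequences Ω n k m) g) =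
      if addOrderOf g ∣ m then
        Nat.card (periodicSequences Ω (n / addOrderOf g) k (m / addOrderOf g))
      else 0 := by
  have hdvd : addOrderOf g ∣ n := by simpa using addOrderOf_dvd_natCard g
  have h := card_periodic_mem_periodicSequences_mul (Ω := Ω) (k := k) (m := m)
    (d := n / addOrderOf g) (addOrderOf_pos g).ne'
  rw [Nat.mul_div_cancel' hdvd] at h
  rw [← h]
  exact Nat.card_congr ((Equiv.subtypeEquivRight fun b => vadd_eq_self_iff g b).trans
    (Equiv.subtypeSubtypeEquivSubtypeInter (· ∈ periodicSequences Ω n k m)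
      (Function.Periodic · (n / addOrderOf g))))

end Rotations

theorem sum_addOrderOf {G M : Type*} [AddGroup G] [IsAddCyclic G] [Fintype G] [AddCommMonoid M]
    (f : ℕ → M) :
    ∑ g : G, f (addOrderOf g) = ∑ e ∈ (Fintype.card G).divisors, e.totient • f e := by
  rw [← Finset.sum_fiberwise_of_maps_to (g := addOrderOf) fun g _ =>
    Nat.mem_divisors.mpr ⟨addOrderOf_dvd_card (x := g), Fintype.card_ne_zero⟩]
  refine Finset.sum_congr rfl fun e he => ?_
  rw [Finset.sum_congr rfl fun g hg => by rw [(Finset.mem_filter.mp hg).2], Finset.sum_const,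
    IsAddCyclic.card_addOrderOf_eq_totient (Nat.dvd_of_mem_divisors he)]

theorem sum_divisors_totient_smul_ite_dvd {M : Type*} [AddCommMonoid M] {m n : ℕ} (hn : n ≠ 0)
    (hmn : m ∣ n) (f : ℕ → M) :
    ∑ e ∈ n.divisors, e.totient • (if e ∣ m then f (m / e) else 0) =
      ∑ r ∈ m.divisors, (m / r).totient • f r := by
  rw [← Nat.sum_div_divisors m fun r => (m / r).totient • f r]
  simp only [smul_ite, smul_zero]
  rw [← Finset.sum_filter, Nat.divisors_filter_dvd_of_dvd hn hmn]
  refine Finset.sum_congr rfl fun e he => ?_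
  rw [Nat.div_div_self (Nat.dvd_of_mem_divisors he) (Nat.ne_zero_of_mem_divisors he)]

section Cycles

theorem rotate_map_range {α : Type*} {n : ℕ} {b : ℕ → α} (hb : Function.Periodic b n) (c : ℕ) :
    ((List.range n).map b).rotate c = (List.range n).map fun i => b (i + c) := by
  refine List.ext_getElem (by simp) fun i _ _ => ?_
  simp [List.getElem_rotate, hb.map_mod_nat]

theorem injOn_map_range_periodic {α : Type*} {n : ℕ} (hn : n ≠ 0) :
    Set.InjOn (fun b => (List.range n).map b) {b : ℕ → α | Function.Periodic b n} := by
  intro b hb b' hb' h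
  ext i
  rw [← hb.map_mod_nat, ← hb'.map_mod_nat]
  exact List.map_inj_left.mp h _ (List.mem_range.mpr (Nat.mod_lt i (Nat.pos_of_ne_zero hn)))

variable {Ω : Type*} [DecidableEq Ω] {n k m : ℕ}

theorem listOccurrences_map_range (hn : n ≠ 0) {b : ℕ → Ω} (hb : Function.Periodic b n)
    (y : Fin k → Ω) :
    listOccurrences y ((List.range n).map b) = Nat.count (fun i => window k b i = y) n := by
  rw [listOccurrences, Nat.count_eq_card_filter_range]
  simp [Nat.mod_lt _ (Nat.pos_of_ne_zero hn), hb.map_mod_nat, window, funext_iff]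

theorem sum_count_window [Fintype Ω] (k : ℕ) (b : ℕ → Ω) (n : ℕ) :
    ∑ y, Nat.count (fun i => window k b i = y) n = n := by
  simp only [Nat.count_eq_card_filter_range]
  rw [← Finset.card_eq_sum_card_fiberwise fun _ _ => Finset.mem_coe.mpr (Finset.mem_univ _),
    Finset.card_range]

/-- The cyclic sequence formed by a period of a periodic sequence. -/
def toCycle (b : periodicSequences Ω n k m) : Cycle Ω :=
  ((List.range n).map b.1 : List Ω)

theorem toCycle_eq_iff [NeZero n] (b b' : periodicSequences Ω n k m) :
    toCycle b = toCycle b' ↔ AddAction.orbitRel (ZMod n) (periodicSequences Ω n k m) b b' := by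
  rw [AddAction.orbitRel_apply, eq_comm, toCycle, toCycle, Cycle.coe_eq_coe]
  constructor
  · rintro ⟨c, hc⟩
    have hvadd : ((c : ZMod n) +ᵥ b').1 = fun i => b'.1 (i + c) := funext fun i => by
      rw [vadd_apply, ZMod.val_natCast, ← b'.2.1.map_mod_nat, Nat.add_mod_mod, b'.2.1.map_mod_nat]
    rw [rotate_map_range b'.2.1, ← hvadd] at hc
    exact ⟨(c : ZMod n), Subtype.ext
      (injOn_map_range_periodic (NeZero.ne n) ((c : ZMod n) +ᵥ b').2.1 b.2.1 hc)⟩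
  · rintro ⟨g, rfl⟩
    exact ⟨g.val, rotate_map_range b'.2.1 _⟩

theorem toCycle_mem_cyclicMultiDeBruijn (hn : n ≠ 0) (b : periodicSequences Ω n k m) :
    toCycle b ∈ cyclicMultiDeBruijn Ω m k :=
  fun y => (listOccurrences_map_range hn b.2.1 y).trans (b.2.2 y)

theorem finite_periodicSequences [Finite Ω] (hn : n ≠ 0) (k m : ℕ) :
    (periodicSequences Ω n k m).Finite :=
  .of_injOn (t := {l : List Ω | l.length = n}) (fun _ _ => by simp)
    ((injOn_map_range_periodic hn).mono fun _ hb => hb.1) (List.finite_length_eq Ω n)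

variable [Fintype Ω]

theorem exists_toCycle_eq [Nonempty Ω] (hm : m ≠ 0) {c : Cycle Ω}
    (hc : c ∈ cyclicMultiDeBruijn Ω m k) :
    ∃ b : periodicSequences Ω (m * Fintype.card Ω ^ k) k m, toCycle b = c := by
  obtain ⟨s, rfl⟩ := Quotient.exists_rep c
  replace hc : ∀ y : Fin k → Ω, listOccurrences y s = m := hc
  have hs : s ≠ [] := by
    rintro rfl
    obtain ⟨a⟩ := ‹Nonempty Ω›
    exact hm (by simpa [listOccurrences] using (hc fun _ => a).symm)
  obtain ⟨b, hb, hbs⟩ := exists_periodic_map_range_eq hs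
  have hcount (y : Fin k → Ω) : Nat.count (fun i => window k b i = y) s.length = m := by
    rw [← listOccurrences_map_range (by simpa using hs) hb, hbs, hc]
  have hlen : s.length = m * Fintype.card Ω ^ k := by
    rw [← sum_count_window k b s.length, Finset.sum_congr rfl fun y _ => hcount y, Finset.sum_const,
      Finset.card_univ, Fintype.card_pi_const, smul_eq_mul, mul_comm]
  rw [hlen] at hb hcount hbs
  exact ⟨⟨b, hb, hcount⟩, congrArg _ hbs⟩

theorem range_toCycle [Nonempty Ω] (hm : m ≠ 0) :
    Set.range (toCycle (Ω := Ω) (n := m * Fintype.card Ω ^ k) (k := k) (m := m)) =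
      cyclicMultiDeBruijn Ω m k :=
  Set.Subset.antisymm
    (Set.range_subset_iff.mpr (toCycle_mem_cyclicMultiDeBruijn (by positivity)))
    fun _ hc => exists_toCycle_eq hm hc

end Cycles

section Count

variable {Ω : Type*} [DecidableEq Ω] {n k m : ℕ}

theorem ncard_range_toCycle_mul [Finite Ω] [NeZero n] :
    (Set.range (toCycle (Ω := Ω) (n := n) (k := k) (m := m))).ncard * n =
      ∑ g : ZMod n, Nat.card (AddAction.fixedBy (periodicSequences Ω n k m) g) := by
  classical
  have := (finite_periodicSequences (Ω := Ω) (NeZero.ne n) k m).fintype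
  have hker : Setoid.ker (toCycle (Ω := Ω) (n := n) (k := k) (m := m)) =
      AddAction.orbitRel (ZMod n) (periodicSequences Ω n k m) :=
    Setoid.ext toCycle_eq_iff
  rw [← Nat.card_coe_set_eq, ← Nat.card_congr (Setoid.quotientKerEquivRange _), hker,
    Nat.card_eq_fintype_card]
  simp only [Nat.card_eq_fintype_card]
  rw [AddAction.sum_card_fixedBy_eq_card_orbits_mul_card_addGroup, ZMod.card]

variable [Fintype Ω]

theorem ncard_cyclicMultiDeBruijn_mul [Nonempty Ω] (hm : m ≠ 0) (K : ℕ) :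
    (cyclicMultiDeBruijn Ω m (K + 1)).ncard * (m * Fintype.card Ω ^ (K + 1)) =
      ∑ r ∈ m.divisors,
        (m / r).totient * Nat.card (wordsWithCounts fun _ : Ω => r) ^ Fintype.card Ω ^ K := by
  set n := m * Fintype.card Ω ^ (K + 1)
  have : NeZero n := ⟨by positivity⟩
  have hfixed (g : ZMod n) :
      Nat.card (AddAction.fixedBy (periodicSequences Ω n (K + 1) m) g) =
        if addOrderOf g ∣ m then
          Nat.card (wordsWithCounts fun _ : Ω => m / addOrderOf g) ^ Fintype.card Ω ^ K
        else 0 := by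
    rw [card_fixedBy_periodicSequences]
    refine ite_congr rfl (fun hg => ?_) fun _ => rfl
    have hdiv : n / addOrderOf g = m / addOrderOf g * Fintype.card Ω ^ (K + 1) :=
      Nat.mul_div_right_comm hg _
    rw [hdiv, card_periodicSequences
      (Nat.div_ne_zero_iff_of_dvd hg |>.mpr ⟨hm, (addOrderOf_pos g).ne'⟩)]
  rw [← range_toCycle hm, ncard_range_toCycle_mul, Finset.sum_congr rfl fun g _ => hfixed g,
    sum_addOrderOf fun e =>
      if e ∣ m then Nat.card (wordsWithCounts fun _ : Ω => m / e) ^ Fintype.card Ω ^ K else 0,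
    ZMod.card, sum_divisors_totient_smul_ite_dvd (NeZero.ne n) (Dvd.intro _ rfl) fun r =>
      Nat.card (wordsWithCounts fun _ : Ω => r) ^ Fintype.card Ω ^ K]
  simp only [smul_eq_mul]

theorem W_eq_card_wordsWithCounts (r K : ℕ) :
    W r (Fintype.card Ω) (K + 1) =
      (Nat.card (wordsWithCounts fun _ : Ω => r) : ℚ) ^ Fintype.card Ω ^ K := by
  have h := Nat.multinomial_spec Finset.univ fun _ : Ω => r
  rw [Finset.prod_const, Finset.sum_const, Finset.card_univ, smul_eq_mul, mul_comm _ r] at h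
  rw [W, Nat.add_sub_cancel, card_wordsWithCounts, ← h, Nat.cast_mul, Nat.cast_pow,
    mul_div_cancel_left₀ _ (by positivity)]

end Count

end MultiDeBruijn

theorem mainTheorem1 {Ω : Type*} [Fintype Ω] [DecidableEq Ω] (m q k : ℕ)
    (hm : 1 ≤ m) (hq : 1 ≤ q) (hk : 1 ≤ k) (hΩ : Fintype.card Ω = q) :
    (MultiDeBruijn.cyclicMultiDeBruijn Ω m k).Finite ∧
      ((MultiDeBruijn.cyclicMultiDeBruijn Ω m k).ncard : ℚ) =
        1 / ((m : ℚ) * (q : ℚ) ^ k) *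
          ∑ r ∈ m.divisors, (Nat.totient (m / r) : ℚ) * MultiDeBruijn.W r q k := by
  subst hΩ
  have : Nonempty Ω := Fintype.card_pos_iff.mp hq
  have hm₀ : m ≠ 0 := Nat.one_le_iff_ne_zero.mp hm
  obtain ⟨K, rfl⟩ := Nat.exists_eq_add_of_le' hk
  constructor
  · rw [← MultiDeBruijn.range_toCycle hm₀]
    have := (MultiDeBruijn.finite_periodicSequences (Ω := Ω)
      (n := m * Fintype.card Ω ^ (K + 1)) (by positivity) (K + 1) m).to_subtype
    exact Set.finite_range _
  · have h := MultiDeBruijn.ncard_cyclicMultiDeBruijn_mul (Ω := Ω) hm₀ K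
    simp only [MultiDeBruijn.W_eq_card_wordsWithCounts]
    rw [one_div, eq_inv_mul_iff_mul_eq₀ (by positivity), mul_comm]
    exact_mod_cast h
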